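/- Let $\mathbb{R}_{\max}=\mathbb{R}\cup\{-\infty\}$, let $\bot$ be the vector with all entries $-\infty$, and let $n,p\ge 1$. Let $V\in\mathbb{R}_{\max}^{n\times p}$ be a matrix with columns $v^{(1)},\dots,v^{(p)}$, and $\mathcal V=\{v^{(1)},\dots,v^{(p)}\}$. When $V$ has no identically $-\infty$ row or column, define $T=T_V:\mathbb{R}_{\max}^n\to\mathbb{R}_{\max}^n$ by $$T_i(x)=\min_{k:\,V_{ik}\neq-\infty}\Big[-V_{ik}+\max_{j\ne i}(V_{jk}+x_j)\Big]\qquad(\max\emptyset=-\infty),$$ and $\rho(T)=\sup\{\lambda\in\mathbb{R}_{\max}\mid \exists u\in\mathbb{R}_{\max}^n,\ u\ne\bot,\ T(u)=\lambda+u\}$, where $\lambda+u$ denotes the vector with entries $\lambda+u_i$. Let $d(x,y)=\inf\{\lambda-\mu\mid \lambda,\mu\in\mathbb{R},\ \mu+y_i\le x_i\le\lambda+y_i\ \forall i\}$ (with $d(\bot,\bot)=0$, $\inf\emptyset=+\infty$) be Hilbert's projective metric on $\mathbb{R}_{\max}^n$, let $B(c,r)=\{x\in\mathbb{R}_{\max}^n\mid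 d(x,c)\le r\}$, and let $\operatorname{dist}_H(x,B)=\inf_{b\in B}d(x,b)$ and $\operatorname{dist}_H(A,B)=\sup_{x\in A}\operatorname{dist}_H(x,B)$. For $b\in\mathbb{R}_{\max}^n$, $b\neq\bot$, let $\mathcal H_b$ be the set of $x\in\mathbb{R}_{\max}^n$ such that $\max_i(b_i+x_i)$ is achieved at least twice, and for $a\in\mathbb{R}^n$ let $S_i(a)=\{x\in\mathbb{R}_{\max}^n\mid x_i+a_i\ge x_j+a_j\ \forall j\}$. Let $\operatorname{Sp}(\mathcal V)$ be the smallest subset of $\mathbb{R}_{\max}^n$ containing $\mathcal V$ and stable under entrywise maximum and under $x\mapsto\lambda+x$, $\lambda\in\mathbb{R}_{\max}$. Suppose that all the vectors of $\mathcal V$ have finite entries. Then there is a vector $a\in\mathbb{R}^n$ such that $T(a)=\rho(T)+a$; moreover $\rho(T)\in\mathbb{R}$ if $n\ge 2$. Consequently, the following optimality certificate applies. For all $a\in\mathbb{R}^n$, one has $T(a)=\rho(T)+a$ if and only if $\mathcal H_a$ has a witness point in each sector, i.e., for all $i\in\{1,\dots,n\}$ there is $k\in\{1,\dots,p\}$ with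 $v^{(k)}\in S_i(a)$ and $\operatorname{dist}_H(v^{(k)},\mathcal H_a)=\operatorname{dist}_H(\mathcal V,\mathcal H_a)$. If these conditions hold, then $\rho(T)=-\operatorname{dist}_H(\mathcal V,\mathcal H_a)$; the hyperplane $\mathcal H_a$ minimizes $\operatorname{dist}_H(\mathcal V,\mathcal H_b)$ over all $b\in\mathbb{R}_{\max}^n$, $b\neq\bot$; and $B(-a,\operatorname{dist}_H(\mathcal V,\mathcal H_a))$ is included in $\operatorname{Sp}(\mathcal V)$ and its radius is the supremum of the $r\in[0,+\infty]$ such that $B(c,r)\subset\operatorname{Sp}(\mathcal V)$ for some $c\in\mathbb{R}^n$. -/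

import Mathlib

namespace TropReg

/-- The max-plus semifield `ℝ ∪ {-∞}`: its tropical addition is `⊔`, its tropical
multiplication is `+`, with `⊥ + x = x + ⊥ = ⊥`. -/
abbrev Rmax : Type := WithBot ℝ

/-- The inclusion of `ℝ ∪ {-∞}` in the extended reals. -/
noncomputable def toEReal (x : Rmax) : EReal :=
  WithBot.recBotCoe (C := fun _ => EReal) ⊥ (fun r : ℝ => (r : EReal)) x

/-- A vector of real numbers, seen as a vector over `Rmax`. -/
def toRmax {n : ℕ} (a : Fin n → ℝ) : Fin n → Rmax := fun i => ((a i : ℝ) : Rmax)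

/-- The vector `c + x`, with entries `c + x i` (tropical scalar multiplication). -/
def shift {n : ℕ} (c : Rmax) (x : Fin n → Rmax) : Fin n → Rmax := fun i => c + x i

/-- The matrix `V` has no identically `-∞` row and no identically `-∞` column. -/
def NoBotRowCol {n p : ℕ} (V : Matrix (Fin n) (Fin p) Rmax) : Prop :=
  (∀ i, ∃ k, V i k ≠ ⊥) ∧ (∀ k, ∃ i, V i k ≠ ⊥)

open Classical in
/-- The set of columns `k` with `V i k ≠ -∞`. -/
noncomputable def finiteCols {n p : ℕ} (V : Matrix (Fin n) (Fin p) Rmax) (i : Fin n) :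
    Finset (Fin p) :=
  Finset.univ.filter (fun k => V i k ≠ ⊥)

theorem finiteCols_nonempty {n p : ℕ} {V : Matrix (Fin n) (Fin p) Rmax}
    (hV : NoBotRowCol V) (i : Fin n) : (finiteCols V i).Nonempty := by
  obtain ⟨k, hk⟩ := hV.1 i
  exact ⟨k, by simp [finiteCols, hk]⟩

/-- The Shapley operator `T = T_V` of the matrix `V`,
`T_i(x) = min_{k, V_ik ≠ -∞} (-V_ik + max_{j ≠ i} (V_jk + x_j))`,
the maximum of an empty family being `-∞`. The default value in `unbotD` is never used,
since `V i k ≠ ⊥` for all `k` over which the minimum is taken. -/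
noncomputable def shapley {n p : ℕ} (V : Matrix (Fin n) (Fin p) Rmax) (hV : NoBotRowCol V)
    (x : Fin n → Rmax) : Fin n → Rmax := fun i =>
  (finiteCols V i).inf' (finiteCols_nonempty hV i) (fun k =>
    ((-((V i k).unbotD 0) : ℝ) : Rmax) + (Finset.univ.erase i).sup (fun j => V j k + x j))

/-- The spectral radius `ρ(T)`: the supremum of the `c ∈ ℝ ∪ {-∞}` such that `T(u) = c + u`
for some vector `u` over `ℝ ∪ {-∞}` that is not identically `-∞`. -/
noncomputable def spectralRad {n : ℕ} (T : (Fin n → Rmax) → (Fin n → Rmax)) : EReal :=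
  sSup {t : EReal | ∃ c : Rmax, t = toEReal c ∧ ∃ u : Fin n → Rmax, u ≠ ⊥ ∧ T u = shift c u}

/-- `T(a) = ρ(T) + a`, for a vector `a` of real numbers. -/
def IsFiniteEigenvector {n : ℕ} (T : (Fin n → Rmax) → (Fin n → Rmax)) (a : Fin n → ℝ) : Prop :=
  ∀ i, toEReal (T (toRmax a) i) = spectralRad T + (a i : EReal)

open Classical in
/-- Hilbert's projective metric `d(x, y)` on vectors over `ℝ ∪ {-∞}`. -/
noncomputable def hilbertDist {n : ℕ} (x y : Fin n → Rmax) : EReal :=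
  if x = ⊥ ∧ y = ⊥ then 0
  else sInf {t : EReal | ∃ l m : ℝ, t = ((l - m : ℝ) : EReal) ∧
    ∀ i, (m : Rmax) + y i ≤ x i ∧ x i ≤ (l : Rmax) + y i}

/-- The distance `dist_H(x, B) = inf_{b ∈ B} d(x, b)` from a point to a set. -/
noncomputable def pointDist {n : ℕ} (x : Fin n → Rmax) (B : Set (Fin n → Rmax)) : EReal :=
  ⨅ b ∈ B, hilbertDist x b

/-- The one-sided Hausdorff distance `dist_H(A, B) = sup_{x ∈ A} dist_H(x, B)`. -/
noncomputable def setDist {n : ℕ} (A B : Set (Fin n → Rmax)) : EReal :=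
  ⨆ x ∈ A, pointDist x B

/-- The closed ball with center `c ∈ ℝⁿ` and radius `r` for Hilbert's projective metric. -/
def hilbertBall {n : ℕ} (c : Fin n → ℝ) (r : EReal) : Set (Fin n → Rmax) :=
  {x | hilbertDist x (toRmax c) ≤ r}

/-- The tropical hyperplane of the vectors `x` such that `max_i (b_i + x_i)` is achieved at
least twice. -/
def hyperplane {n : ℕ} (b : Fin n → Rmax) : Set (Fin n → Rmax) :=
  {x | ∃ i j, i ≠ j ∧ (∀ l, b l + x l ≤ b i + x i) ∧ (∀ l, b l + x l ≤ b j + x j)}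

/-- The sector `S_i(a)` of the hyperplane given by `a ∈ ℝⁿ`. -/
def sector {n : ℕ} (a : Fin n → ℝ) (i : Fin n) : Set (Fin n → Rmax) :=
  {x | ∀ j, x j + (a j : Rmax) ≤ x i + (a i : Rmax)}

/-- Tropical (convex) cones. -/
def IsTropicalCone {n : ℕ} (C : Set (Fin n → Rmax)) : Prop :=
  (∀ x ∈ C, ∀ c : Rmax, shift c x ∈ C) ∧ (∀ x ∈ C, ∀ y ∈ C, x ⊔ y ∈ C)

/-- The tropical cone generated by a set of vectors. -/
def tropicalSpan {n : ℕ} (A : Set (Fin n → Rmax)) : Set (Fin n → Rmax) :=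
  ⋂₀ {C | IsTropicalCone C ∧ A ⊆ C}

/-- The inner radius of `A`: the supremum of the radii of Hilbert's balls that are centered at
a point of `ℝⁿ` and included in the tropical cone generated by `A`. -/
noncomputable def innerRadius {n : ℕ} (A : Set (Fin n → Rmax)) : EReal :=
  sSup {r : EReal | 0 ≤ r ∧ ∃ c : Fin n → ℝ, hilbertBall c r ⊆ tropicalSpan A}

/-- The set of points given by the columns of `V`. -/
def points {n p : ℕ} (V : Matrix (Fin n) (Fin p) Rmax) : Set (Fin n → Rmax) :=
  Set.range (fun k : Fin p => fun i : Fin n => V i k)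

/-- `v` is a witness point of the hyperplane `H_b` for the set of points `A`: it belongs to `A`
and realizes the distance from `A` to `H_b`. -/
def IsWitness {n : ℕ} (A : Set (Fin n → Rmax)) (b v : Fin n → Rmax) : Prop :=
  v ∈ A ∧ pointDist v (hyperplane b) = setDist A (hyperplane b)

/-- `H_b` is an optimal solution of the tropical linear regression problem for `A`. -/
def IsOptimalHyperplane {n : ℕ} (A : Set (Fin n → Rmax)) (b : Fin n → Rmax) : Prop :=
  b ≠ ⊥ ∧ ∀ b' : Fin n → Rmax, b' ≠ ⊥ →
    setDist A (hyperplane b) ≤ setDist A (hyperplane b')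

/-- The ball with center `c` and radius `r` is a Hilbert's ball of maximal radius among those
included in the tropical cone generated by `A`. -/
def IsMaximalInnerBall {n : ℕ} (A : Set (Fin n → Rmax)) (c : Fin n → ℝ) (r : EReal) : Prop :=
  hilbertBall c r ⊆ tropicalSpan A ∧ r = innerRadius A

end TropReg

open TropReg

/-! For `n ≥ 2` the matrix is real, and the distance from a column `v` to `H_a` is the gap between
the two largest entries of `a + v`. Thus `c + a ≤ T(a)` says that every column is within `-c` of
`H_a`, and `T(a) ≤ c + a` says that for each `i` some column has coordinate `i` of `a + v` ahead of
all others by at least `-c`.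

The second inequality carries the duality. Translating `a` until it touches a given vector from
above shows that every `H_b` is at distance at least `-c` (`IsSuperEig.neg_le_setDist`) and that no
eigenvalue of `T` exceeds `c` (`IsSuperEig.le_of_shapley_eq_shift`). It also puts the ball `B(-a,
-c)` in the span (`IsSuperEig.hilbertBall_subset`); conversely an inscribed ball of radius `s ≥ 0`
yields a super-eigenvector for `-s` (`isSuperEig_of_hilbertBall_subset`). So inner radii never
exceed distances to hyperplanes, and an eigenvector gives equality. One exists because finite
entries bound the super-eigenspaces in Hilbert's seminorm (`exists_eigenvector_of_bounded`).

For `n = 1`, `T` is constantly `⊥`, hyperplanes are empty, and distance and inner radius are both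
infinite. -/

open TropReg

namespace TropReg

/-! ### Eigenvectors of monotone homogeneous maps -/

section Existence

variable {ι : Type*} [Fintype ι] [Nonempty ι]

/-- The largest coordinate of `F u - u`. -/
noncomputable def maxExcess (F : (ι → ℝ) → (ι → ℝ)) (u : ι → ℝ) : ℝ :=
  Finset.univ.sup' Finset.univ_nonempty (fun i => F u i - u i)

theorem maxExcess_le_iff {F : (ι → ℝ) → (ι → ℝ)} {u : ι → ℝ} {c : ℝ} :
    maxExcess F u ≤ c ↔ ∀ i, F u i ≤ c + u i := by
  simp [maxExcess, Finset.sup'_le_iff]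

theorem continuous_maxExcess {F : (ι → ℝ) → (ι → ℝ)} (hF : Continuous F) :
    Continuous (maxExcess F) := by
  unfold maxExcess
  apply Continuous.finset_sup'_apply
  intro i _
  exact ((continuous_apply i).comp hF).sub (continuous_apply i)

/-- If the sets `{u | F u ≤ c + u}` are bounded in Hilbert's seminorm, then `maxExcess F` attains
its minimum. -/
theorem exists_forall_maxExcess_le {F : (ι → ℝ) → (ι → ℝ)} (hF : Continuous F)
    (hadd : ∀ (u : ι → ℝ) (c : ℝ), F (fun i => u i + c) = fun i => F u i + c)
    (hbdd : ∀ c : ℝ, ∃ C : ℝ, ∀ u, (∀ i, F u i ≤ c + u i) → ∀ i j, u i ≤ u j + C) :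
    ∃ u, ∀ v, maxExcess F u ≤ maxExcess F v := by
  obtain ⟨C, hC⟩ := hbdd (maxExcess F 0)
  obtain ⟨i₀⟩ := ‹Nonempty ι›
  have hC0 : 0 ≤ C := by
    have := hC 0 (maxExcess_le_iff.1 le_rfl) i₀ i₀
    simpa using this
  obtain ⟨u, -, hu⟩ := (isCompact_closedBall (0 : ι → ℝ) C).exists_isMinOn
    ⟨0, by simpa using hC0⟩ (continuous_maxExcess hF).continuousOn
  refine ⟨u, fun v => ?_⟩
  -- Translation leaves `maxExcess` unchanged. Normalizing coordinate `i₀` to `0` moves any point of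
  -- the sublevel set of `0` into the ball of radius `C`.
  by_cases hv : maxExcess F v ≤ maxExcess F 0
  · have hshift : maxExcess F (fun i => v i + -v i₀) = maxExcess F v := by
      simp [maxExcess, hadd v (-v i₀)]
    rw [← hshift]
    refine hu (mem_closedBall_zero_iff.2 ((pi_norm_le_iff_of_nonneg hC0).2 fun i => ?_))
    have hv' := hC v (maxExcess_le_iff.1 hv)
    have h1 := hv' i i₀
    have h2 := hv' i₀ i
    rw [Real.norm_eq_abs, abs_le]
    constructor <;> linarith
  · exact (hu (by simpa using hC0)).trans (not_le.1 hv).le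

/-- A monotone, additively homogeneous map whose super-eigenspaces are bounded in Hilbert's
seminorm has an eigenvector. -/
theorem exists_eigenvector_of_bounded {F : (ι → ℝ) → (ι → ℝ)} (hF : Continuous F)
    (hmono : Monotone F)
    (hadd : ∀ (u : ι → ℝ) (c : ℝ), F (fun i => u i + c) = fun i => F u i + c)
    (hbdd : ∀ c : ℝ, ∃ C : ℝ, ∀ u, (∀ i, F u i ≤ c + u i) → ∀ i j, u i ≤ u j + C) :
    ∃ (c : ℝ) (a : ι → ℝ), ∀ i, F a i = c + a i := by
  obtain ⟨u, hu⟩ := exists_forall_maxExcess_le hF hadd hbdd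
  set c := maxExcess F u with hc
  set G : (ι → ℝ) → (ι → ℝ) := fun x i => F x i - c with hG
  have hGmono : Monotone G := fun x y hxy i => sub_le_sub_right (hmono hxy i) c
  have hGcont : Continuous G := by
    refine continuous_pi fun i => ?_
    exact ((continuous_apply i).comp hF).sub continuous_const
  have hGadd : ∀ (x : ι → ℝ) (t : ℝ), G (fun i => x i + t) = fun i => G x i + t := by
    intro x t
    funext i
    simp only [hG, hadd x t]
    ring
  have hGu : G u ≤ u := fun i => by
    have := maxExcess_le_iff.1 hc.ge i
    simp only [hG]
    linarith
  have hanti : Antitone fun k : ℕ => G^[k] u := hGmono.antitone_iterate_of_map_le hGu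
  obtain ⟨C, hC⟩ := hbdd c
  have hosc : ∀ (k : ℕ) i j, G^[k] u i ≤ G^[k] u j + C := by
    intro k
    refine hC _ fun i => ?_
    have := hanti (Nat.le_succ k) i
    simp only [Function.iterate_succ_apply'] at this
    simp only [hG] at this ⊢
    linarith
  -- The decreasing orbit of `u` under `G` either converges to a fixed point or is unbounded below;
  -- the latter would contradict the minimality of `c`.
  by_cases hb : ∀ i, BddBelow (Set.range fun k : ℕ => G^[k] u i)
  · have hlim : Filter.Tendsto (fun k : ℕ => G^[k] u) Filter.atTop
        (nhds fun i => ⨅ k : ℕ, G^[k] u i) :=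
      tendsto_pi_nhds.2 fun i => tendsto_atTop_ciInf (fun k l hkl => hanti hkl i) (hb i)
    have hfix := isFixedPt_of_tendsto_iterate hlim hGcont.continuousAt
    refine ⟨c, fun i => ⨅ k : ℕ, G^[k] u i, fun i => ?_⟩
    have := congrFun hfix i
    simp only [hG] at this
    simp only [hG]
    linarith
  · exfalso
    push Not at hb
    obtain ⟨i, hi⟩ := hb
    rw [not_bddBelow_iff] at hi
    -- As the oscillation is at most `C`, one coordinate this low puts every coordinate below `-1 -
    -- ‖u‖`, so `G^[k] u ≤ u - 1`.
    obtain ⟨_, ⟨k, rfl⟩, hk⟩ := hi (-C - 1 - ‖u‖)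
    have hdrop : ∀ j, G^[k] u j ≤ u j - 1 := by
      intro j
      have h1 := hosc k j i
      have h2 : -‖u‖ ≤ u j := (abs_le.1 (norm_le_pi_norm u j)).1
      simp only at hk
      linarith
    have hk0 : k ≠ 0 := by
      rintro rfl
      have := hdrop i
      simp only [Function.iterate_zero, id] at this
      linarith
    have hkpos : (0 : ℝ) < k := by exact_mod_cast Nat.pos_of_ne_zero hk0
    have hne : (Finset.range k).Nonempty := Finset.nonempty_range_iff.2 hk0
    set e : ℝ := 1 / k with he
    have hepos : 0 < e := by positivity
    have hek : k * e = 1 := by rw [he]; field_simp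
    -- Spreading the drop of `1` evenly over the `k` steps gives `G v ≤ v - e`. Term `j + 1` is
    -- controlled by term `j`, and term `0` by term `k - 1` together with the drop.
    set v : ι → ℝ := fun i => (Finset.range k).inf' hne fun j => G^[j] u i + j * e with hv
    have hstep : ∀ j < k, ∀ i, G v i ≤ G^[j + 1] u i + j * e := by
      intro j hj i
      have h1 : v ≤ fun i => G^[j] u i + j * e := fun i =>
        Finset.inf'_le (fun j : ℕ => G^[j] u i + j * e) (Finset.mem_range.2 hj)
      have h2 := hGmono h1 i
      rw [hGadd] at h2
      rwa [Function.iterate_succ_apply']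
    have hGv : ∀ i, G v i + e ≤ v i := by
      intro i
      refine Finset.le_inf' _ _ fun j hj => ?_
      rcases j with _ | j
      · have h1 := hstep (k - 1) (by omega) i
        rw [Nat.sub_add_cancel (by omega), Nat.cast_sub (by omega)] at h1
        have h2 := hdrop i
        simp only [Function.iterate_zero, id]
        push_cast at h1 ⊢
        linarith
      · have h1 := hstep j (by have := Finset.mem_range.1 hj; omega) i
        push_cast
        linarith
    have hlt : maxExcess F v ≤ c - e := maxExcess_le_iff.2 fun i => by
      have := hGv i
      simp only [hG] at this
      linarith
    have := hu v
    linarith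

end Existence

/-! ### Super- and sub-eigenvectors of the Shapley operator of a real matrix -/

section Shapley

variable {n p : ℕ}

/-- `T(a) ≤ c + a`, for the Shapley operator `T` of the real matrix `W`. -/
def IsSuperEig (W : Fin n → Fin p → ℝ) (c : ℝ) (a : Fin n → ℝ) : Prop :=
  ∀ i, ∃ k, ∀ j, j ≠ i → W j k + a j ≤ W i k + (c + a i)

/-- `c + a ≤ T(a)`, for the Shapley operator `T` of the real matrix `W`. -/
def IsSubEig (W : Fin n → Fin p → ℝ) (c : ℝ) (a : Fin n → ℝ) : Prop :=
  ∀ i k, ∃ j, j ≠ i ∧ W i k + (c + a i) ≤ W j k + a j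

/-- The matrix over `Rmax` given by a real matrix. -/
def coeMatrix (W : Fin n → Fin p → ℝ) : Matrix (Fin n) (Fin p) Rmax := fun i k => (W i k : Rmax)

theorem exists_superEig_subEig [Nonempty (Fin p)] (hn : 2 ≤ n) (W : Fin n → Fin p → ℝ) :
    ∃ (c : ℝ) (a : Fin n → ℝ), IsSuperEig W c a ∧ IsSubEig W c a := by
  have : Nontrivial (Fin n) := Fin.nontrivial_iff_two_le.2 hn
  have hne : ∀ i : Fin n, (Finset.univ.erase i).Nonempty := fun i => by
    obtain ⟨j, hj⟩ := exists_ne i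
    exact ⟨j, by simp [hj]⟩
  let F : (Fin n → ℝ) → (Fin n → ℝ) := fun x i =>
    Finset.univ.inf' Finset.univ_nonempty fun k : Fin p =>
      (Finset.univ.erase i).sup' (hne i) fun j => W j k - W i k + x j
  -- Monotonicity, homogeneity and boundedness all follow from these two characterizations of the
  -- min-max.
  have hle : ∀ x i s, F x i ≤ s ↔ ∃ k, ∀ j, j ≠ i → W j k + x j ≤ W i k + s := by
    intro x i s
    simp only [F, Finset.inf'_le_iff, Finset.sup'_le_iff, Finset.mem_univ, Finset.mem_erase,
      true_and, and_true]
    refine exists_congr fun k => forall_congr' fun j => imp_congr_right fun _ => ?_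
    constructor <;> intro h <;> linarith
  have hge : ∀ x i s, s ≤ F x i ↔ ∀ k, ∃ j, j ≠ i ∧ W i k + s ≤ W j k + x j := by
    intro x i s
    simp only [F, Finset.le_inf'_iff, Finset.le_sup'_iff, Finset.mem_univ, Finset.mem_erase,
      and_true, forall_true_left]
    refine forall_congr' fun k => exists_congr fun j => and_congr_right fun _ => ?_
    constructor <;> intro h <;> linarith
  have hcont : Continuous F := by
    refine continuous_pi fun i => ?_
    apply Continuous.finset_inf'_apply
    intro k _
    apply Continuous.finset_sup'_apply
    intro j _
    fun_prop
  have hmono : Monotone F := by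
    intro x y hxy i
    rw [hle]
    obtain ⟨k, hk⟩ := (hle y i _).1 le_rfl
    exact ⟨k, fun j hj => by linarith [hk j hj, hxy j]⟩
  have hadd : ∀ (u : Fin n → ℝ) (c : ℝ), F (fun i => u i + c) = fun i => F u i + c := by
    intro u c
    funext i
    apply le_antisymm
    · rw [hle]
      obtain ⟨k, hk⟩ := (hle u i _).1 le_rfl
      exact ⟨k, fun j hj => by linarith [hk j hj]⟩
    · rw [hge]
      intro k
      obtain ⟨j, hj, hjk⟩ := (hge u i _).1 le_rfl k
      exact ⟨j, hj, by linarith⟩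
  have hbdd : ∀ c : ℝ, ∃ C : ℝ, ∀ u, (∀ i, F u i ≤ c + u i) → ∀ i j, u i ≤ u j + C := by
    intro c
    obtain ⟨M, hM⟩ := (Set.finite_range fun q : Fin n × Fin n × Fin p =>
      W q.1 q.2.2 - W q.2.1 q.2.2).bddAbove
    -- `M` bounds the differences of entries within a column; the `0` covers `i = j`.
    refine ⟨max 0 (M + c), fun u hu i j => ?_⟩
    by_cases hij : i = j
    · subst hij
      linarith [le_max_left 0 (M + c)]
    · obtain ⟨k, hk⟩ := (hle _ _ _).1 (hu j)
      have h1 := hk i hij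
      have h2 := hM ⟨(j, i, k), rfl⟩
      simp only at h2
      linarith [le_max_right 0 (M + c)]
  obtain ⟨c, a, hca⟩ := exists_eigenvector_of_bounded hcont hmono hadd hbdd
  exact ⟨c, a, fun i => (hle _ _ _).1 (hca i).le, fun i => (hge _ _ _).1 (hca i).ge⟩

theorem finiteCols_coeMatrix (W : Fin n → Fin p → ℝ) (i : Fin n) :
    finiteCols (coeMatrix W) i = Finset.univ := by
  simp [finiteCols, coeMatrix]

theorem neg_coe_add_le_iff (w : ℝ) (z s : Rmax) :
    ((-w : ℝ) : Rmax) + z ≤ s ↔ z ≤ (w : Rmax) + s := by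
  induction z using WithBot.recBotCoe with
  | bot => simp
  | coe z =>
    induction s using WithBot.recBotCoe with
    | bot => rw [← WithBot.coe_add]; simp
    | coe s => norm_cast; constructor <;> intro h <;> linarith

theorem le_neg_coe_add_iff (w : ℝ) (z s : Rmax) :
    s ≤ ((-w : ℝ) : Rmax) + z ↔ (w : Rmax) + s ≤ z := by
  have := neg_coe_add_le_iff (-w) s z
  rw [neg_neg] at this
  exact this.symm

theorem shapley_coeMatrix_le_iff {W : Fin n → Fin p → ℝ} (hV : NoBotRowCol (coeMatrix W))
    (u : Fin n → Rmax) (i : Fin n) (s : Rmax) :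
    shapley (coeMatrix W) hV u i ≤ s ↔
      ∃ k, ∀ j, j ≠ i → (W j k : Rmax) + u j ≤ (W i k : Rmax) + s := by
  unfold shapley
  simp only [Finset.inf'_le_iff, finiteCols_coeMatrix, Finset.mem_univ, true_and, coeMatrix,
    WithBot.unbotD_coe, neg_coe_add_le_iff, Finset.sup_le_iff, Finset.mem_erase, and_true]

theorem le_shapley_coeMatrix_iff (hn : 2 ≤ n) {W : Fin n → Fin p → ℝ}
    (hV : NoBotRowCol (coeMatrix W)) (u : Fin n → Rmax) (i : Fin n) (s : Rmax) :
    s ≤ shapley (coeMatrix W) hV u i ↔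
      ∀ k, ∃ j, j ≠ i ∧ (W i k : Rmax) + s ≤ (W j k : Rmax) + u j := by
  have : Nontrivial (Fin n) := Fin.nontrivial_iff_two_le.2 hn
  unfold shapley
  simp only [Finset.le_inf'_iff, finiteCols_coeMatrix, Finset.mem_univ, forall_true_left, coeMatrix,
    WithBot.unbotD_coe, le_neg_coe_add_iff]
  refine forall_congr' fun k => ⟨fun h => ?_, ?_⟩
  -- Nonemptiness of the index set matters: an empty maximum is `⊥`, which no `j` attains.
  · obtain ⟨j₀, hj₀⟩ := exists_ne i
    obtain ⟨j, hj, hjs⟩ := Finset.exists_mem_eq_sup (Finset.univ.erase i) ⟨j₀, by simp [hj₀]⟩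
      fun j => (W j k : Rmax) + u j
    exact ⟨j, Finset.ne_of_mem_erase hj, hjs ▸ h⟩
  · rintro ⟨j, hj, h⟩
    exact h.trans (Finset.le_sup (f := fun j => (W j k : Rmax) + u j) (by simp [hj]))

theorem shapley_toRmax_eq_iff (hn : 2 ≤ n) {W : Fin n → Fin p → ℝ}
    (hV : NoBotRowCol (coeMatrix W)) (c : ℝ) (a : Fin n → ℝ) :
    (∀ i, shapley (coeMatrix W) hV (toRmax a) i = ((c + a i : ℝ) : Rmax)) ↔
      IsSuperEig W c a ∧ IsSubEig W c a := by
  simp only [le_antisymm_iff, forall_and]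
  refine and_congr (forall_congr' fun i => ?_) (forall_congr' fun i => ?_)
  · rw [shapley_coeMatrix_le_iff]
    simp only [toRmax]
    norm_cast
  · rw [le_shapley_coeMatrix_iff hn]
    simp only [toRmax]
    norm_cast

/-- A vector `b ≠ ⊥` lies below some translate `t + a` of a real vector, and touches it. -/
theorem exists_touching (a : Fin n → ℝ) {b : Fin n → Rmax} (hb : b ≠ ⊥) :
    ∃ (t : ℝ) (i : Fin n), b i = ((t + a i : ℝ) : Rmax) ∧ ∀ j, b j ≤ ((t + a j : ℝ) : Rmax) := by
  obtain ⟨i₀, hi₀⟩ := Function.ne_iff.1 hb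
  -- The translation `t` is the maximum of `b i - a i`.
  obtain ⟨i, -, hi⟩ := Finset.exists_max_image Finset.univ
    (fun i => ((-a i : ℝ) : Rmax) + b i) ⟨i₀, Finset.mem_univ _⟩
  simp only [Finset.mem_univ, forall_true_left, neg_coe_add_le_iff] at hi
  have hbi : b i ≠ ⊥ := by
    intro h
    have := hi i₀
    rw [h] at this
    simp only [WithBot.add_bot, le_bot_iff] at this
    exact hi₀ this
  obtain ⟨r, hr⟩ := WithBot.ne_bot_iff_exists.1 hbi
  refine ⟨r - a i, i, by rw [← hr]; norm_num, fun j => (hi j).trans ?_⟩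
  rw [← hr]
  norm_cast
  linarith

/-- If `t + a` touches `u` from above at `i`, monotonicity gives `d + u i = T_i(u) ≤ T_i(t + a) ≤ c
+ u i`, with `u i` real. Infinite entries of `u` elsewhere do no harm. -/
theorem IsSuperEig.le_of_shapley_eq_shift (hn : 2 ≤ n) {W : Fin n → Fin p → ℝ}
    (hV : NoBotRowCol (coeMatrix W)) {c : ℝ} {a : Fin n → ℝ} (ha : IsSuperEig W c a) {d : Rmax}
    {u : Fin n → Rmax} (hu : u ≠ ⊥) (h : shapley (coeMatrix W) hV u = shift d u) :
    d ≤ (c : Rmax) := by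
  induction d using WithBot.recBotCoe with
  | bot => exact bot_le
  | coe d =>
    obtain ⟨t, i, hi, hle⟩ := exists_touching a hu
    obtain ⟨k, hk⟩ := ha i
    obtain ⟨j, hj, hjk⟩ := (le_shapley_coeMatrix_iff hn hV u i _).1 (congrFun h i).ge k
    simp only [shift, hi] at hjk
    have h1 := hjk.trans (add_le_add_right (hle j) _)
    norm_cast at h1 ⊢
    linarith [hk j hj]

@[simp] theorem toEReal_coe (r : ℝ) : toEReal (r : Rmax) = (r : EReal) := rfl

@[simp] theorem toEReal_bot : toEReal ⊥ = ⊥ := rfl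

theorem toEReal_eq_coe_iff {x : Rmax} {r : ℝ} : toEReal x = (r : EReal) ↔ x = (r : Rmax) := by
  induction x using WithBot.recBotCoe with
  | bot => simp
  | coe x => rw [toEReal_coe]; norm_cast

theorem toEReal_le_coe {x : Rmax} {r : ℝ} (h : x ≤ (r : Rmax)) : toEReal x ≤ (r : EReal) := by
  induction x using WithBot.recBotCoe with
  | bot => simp
  | coe x => rw [toEReal_coe]; exact_mod_cast h

theorem toRmax_ne_bot (hn : 0 < n) (a : Fin n → ℝ) : toRmax a ≠ ⊥ := fun h =>
  WithBot.coe_ne_bot (congrFun h ⟨0, hn⟩)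

theorem spectralRad_eq_of_eig (hn : 2 ≤ n) {W : Fin n → Fin p → ℝ}
    (hV : NoBotRowCol (coeMatrix W)) {c : ℝ} {a : Fin n → ℝ} (ha : IsSuperEig W c a)
    (ha' : IsSubEig W c a) : spectralRad (shapley (coeMatrix W) hV) = (c : EReal) := by
  apply le_antisymm
  · refine sSup_le ?_
    rintro _ ⟨d, rfl, u, hu, h⟩
    exact toEReal_le_coe (ha.le_of_shapley_eq_shift hn hV hu h)
  · refine le_sSup ⟨c, rfl, toRmax a, toRmax_ne_bot (by omega) a, ?_⟩
    funext i
    rw [(shapley_toRmax_eq_iff hn hV c a).2 ⟨ha, ha'⟩ i]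
    simp [shift, toRmax]

theorem isFiniteEigenvector_iff (hn : 2 ≤ n) {W : Fin n → Fin p → ℝ}
    (hV : NoBotRowCol (coeMatrix W)) {c : ℝ}
    (hc : spectralRad (shapley (coeMatrix W) hV) = (c : EReal)) (a : Fin n → ℝ) :
    IsFiniteEigenvector (shapley (coeMatrix W) hV) a ↔ IsSuperEig W c a ∧ IsSubEig W c a := by
  rw [← shapley_toRmax_eq_iff hn hV, IsFiniteEigenvector, hc]
  simp only [← EReal.coe_add, toEReal_eq_coe_iff]

end Shapley

/-! ### Distances to hyperplanes -/

section Distance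

variable {n p : ℕ}

theorem le_hilbertDist {x y : Fin n → Rmax} (hy : y ≠ ⊥) {g : EReal}
    (h : ∀ l m : ℝ, (∀ i, (m : Rmax) + y i ≤ x i ∧ x i ≤ (l : Rmax) + y i) →
      g ≤ ((l - m : ℝ) : EReal)) : g ≤ hilbertDist x y := by
  rw [hilbertDist, if_neg fun h => hy h.2]
  refine le_sInf ?_
  rintro _ ⟨l, m, rfl, hlm⟩
  exact h l m hlm

theorem hilbertDist_le {x y : Fin n → Rmax} (hy : y ≠ ⊥) {l m : ℝ}
    (h : ∀ i, (m : Rmax) + y i ≤ x i ∧ x i ≤ (l : Rmax) + y i) :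
    hilbertDist x y ≤ ((l - m : ℝ) : EReal) := by
  rw [hilbertDist, if_neg fun h => hy h.2]
  exact sInf_le ⟨l, m, rfl, h⟩

theorem hilbertDist_toRmax_le_iff (hn : 0 < n) {x : Fin n → Rmax} {y : Fin n → ℝ} {r : ℝ} :
    hilbertDist x (toRmax y) ≤ (r : EReal) ↔
      ∃ z : Fin n → ℝ, x = toRmax z ∧ ∀ i j, z i - y i ≤ z j - y j + r := by
  have hy := toRmax_ne_bot hn y
  constructor
  · intro h
    have hfin : ∀ i, x i ≠ ⊥ := by
      intro i hi
      have htop : (⊤ : EReal) ≤ hilbertDist x (toRmax y) := by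
        refine le_hilbertDist hy fun l m hlm => ?_
        have := (hlm i).1
        rw [hi, toRmax, ← WithBot.coe_add] at this
        exact absurd (le_bot_iff.1 this) WithBot.coe_ne_bot
      exact EReal.coe_ne_top r (top_le_iff.1 (htop.trans h))
    choose z hz using fun i => WithBot.ne_bot_iff_exists.1 (hfin i)
    obtain rfl : x = toRmax z := funext fun i => (hz i).symm
    refine ⟨z, rfl, fun i j => ?_⟩
    have hle : ((z i - y i - (z j - y j) : ℝ) : EReal) ≤ hilbertDist (toRmax z) (toRmax y) := by
      refine le_hilbertDist hy fun l m hlm => ?_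
      have h1 := (hlm i).2
      have h2 := (hlm j).1
      simp only [toRmax] at h1 h2
      norm_cast at h1 h2 ⊢
      linarith
    have := EReal.coe_le_coe_iff.1 (hle.trans h)
    linarith
  · rintro ⟨z, rfl, hz⟩
    obtain ⟨i, -, hi⟩ := Finset.exists_max_image Finset.univ (fun i => z i - y i)
      ⟨⟨0, hn⟩, Finset.mem_univ _⟩
    refine (hilbertDist_le hy (l := z i - y i) (m := z i - y i - r) fun j => ?_).trans ?_
    · have h1 := hi j (Finset.mem_univ _)
      have h2 := hz i j
      simp only [toRmax]
      norm_cast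
      constructor <;> linarith
    · norm_cast
      linarith

/-- In a point `y` of the hyperplane some `j ≠ i` is at least level with `i`, so moving from `x` to
`y` must absorb the lead `g` of `i` over `j`. -/
theorem le_pointDist_hyperplane {x : Fin n → ℝ} {b : Fin n → Rmax} {i : Fin n} (hi : b i ≠ ⊥)
    {g : ℝ} (h : ∀ j, j ≠ i → (g : Rmax) + (b j + (x j : Rmax)) ≤ b i + (x i : Rmax)) :
    (g : EReal) ≤ pointDist (toRmax x) (hyperplane b) := by
  refine le_iInf₂ fun y hy => ?_
  obtain ⟨j, hji, hj⟩ : ∃ j, j ≠ i ∧ b i + y i ≤ b j + y j := by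
    obtain ⟨i₁, i₂, hne, h₁, h₂⟩ := hy
    by_cases h : i₁ = i
    · exact ⟨i₂, fun h' => hne (h.trans h'.symm), h₂ i⟩
    · exact ⟨i₁, h, h₁ i⟩
  have key : ∀ l m : ℝ, (∀ i, (m : Rmax) + y i ≤ toRmax x i ∧ toRmax x i ≤ (l : Rmax) + y i) →
      g ≤ l - m := by
    intro l m hlm
    have h1 := (hlm i).2
    have h2 := (hlm j).1
    have h3 := h j hji
    simp only [toRmax] at h1 h2
    obtain ⟨β, hβ⟩ := WithBot.ne_bot_iff_exists.1 hi
    have hyi : y i ≠ ⊥ := fun h => by simp [h] at h1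
    obtain ⟨η, hη⟩ := WithBot.ne_bot_iff_exists.1 hyi
    rw [← hβ, ← hη, ← WithBot.coe_add] at hj
    have hbj : b j ≠ ⊥ := fun h => by simp [h] at hj
    have hyj : y j ≠ ⊥ := fun h => by simp [h] at hj
    obtain ⟨β', hβ'⟩ := WithBot.ne_bot_iff_exists.1 hbj
    obtain ⟨η', hη'⟩ := WithBot.ne_bot_iff_exists.1 hyj
    rw [← hβ', ← hη'] at hj
    rw [← hη] at h1
    rw [← hη'] at h2
    rw [← hβ, ← hβ'] at h3
    norm_cast at hj h1 h2 h3
    linarith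
  by_cases hy0 : y = ⊥
  · subst hy0
    rw [hilbertDist, if_neg fun h => WithBot.coe_ne_bot (congrFun h.1 i)]
    refine le_sInf ?_
    rintro _ ⟨l, m, rfl, hlm⟩
    exact EReal.coe_le_coe_iff.2 (key l m hlm)
  · exact le_hilbertDist hy0 fun l m hlm => EReal.coe_le_coe_iff.2 (key l m hlm)

theorem pointDist_hyperplane_le {x a : Fin n → ℝ} (hn : 0 < n) {r : ℝ}
    (h : ∀ i, ∃ j, j ≠ i ∧ a i + x i ≤ r + (a j + x j)) :
    pointDist (toRmax x) (hyperplane (toRmax a)) ≤ (r : EReal) := by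
  obtain ⟨i, -, hi⟩ := Finset.exists_max_image Finset.univ (fun i => a i + x i)
    ⟨⟨0, hn⟩, Finset.mem_univ _⟩
  obtain ⟨j₁, hj₁, hj₁r⟩ := h i
  obtain ⟨j, hj, hjmax⟩ := Finset.exists_max_image (Finset.univ.erase i) (fun i => a i + x i)
    ⟨j₁, by simp [hj₁]⟩
  have hji := Finset.ne_of_mem_erase hj
  have hjmax' : ∀ l, l ≠ i → a l + x l ≤ a j + x j := fun l hl => hjmax l (by simp [hl])
  have hi' := hi j (Finset.mem_univ _)
  -- Lower the leading coordinate until it ties with the runner-up; the displacement is the gap.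
  set y : Fin n → ℝ := Function.update x i (a j + x j - a i) with hy
  have hyi : y i = a j + x j - a i := by simp [hy]
  have hyl : ∀ l, l ≠ i → y l = x l := fun l hl => by simp [hy, hl]
  have hle : ∀ l, a l + y l ≤ a j + x j := by
    intro l
    by_cases hl : l = i
    · subst hl
      rw [hyi]
      linarith
    · rw [hyl l hl]
      exact hjmax' l hl
  have hmem : toRmax y ∈ hyperplane (toRmax a) := by
    refine ⟨i, j, hji.symm, fun l => ?_, fun l => ?_⟩ <;> simp only [toRmax] <;> norm_cast
    · have := hle l
      rw [hyi]
      linarith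
    · rw [hyl j hji]
      exact hle l
  refine (iInf₂_le _ hmem).trans ((hilbertDist_toRmax_le_iff hn).2 ⟨x, rfl, ?_⟩)
  have h1 := hjmax' j₁ hj₁
  have hbd : ∀ l, 0 ≤ x l - y l ∧ x l - y l ≤ r := by
    intro l
    by_cases hl : l = i
    · subst hl
      rw [hyi]
      constructor <;> linarith
    · rw [hyl l hl]
      constructor <;> linarith
  intro l l'
  linarith [(hbd l).2, (hbd l').1]

theorem pointDist_le_setDist (W : Fin n → Fin p → ℝ) (k : Fin p) (B : Set (Fin n → Rmax)) :
    pointDist (toRmax fun i => W i k) B ≤ setDist (points (coeMatrix W)) B :=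
  le_iSup₂ (f := fun x (_ : x ∈ points (coeMatrix W)) => pointDist x B)
    (toRmax fun i => W i k) ⟨k, rfl⟩

/-- Weak duality: where `t + a` touches `b` from above at `i`, the column chosen for `i` keeps its
lead, since replacing `t + a` by `b` only lowers the other coordinates. -/
theorem IsSuperEig.neg_le_setDist {W : Fin n → Fin p → ℝ} {c : ℝ} {a : Fin n → ℝ}
    (ha : IsSuperEig W c a) {b : Fin n → Rmax} (hb : b ≠ ⊥) :
    ((-c : ℝ) : EReal) ≤ setDist (points (coeMatrix W)) (hyperplane b) := by
  obtain ⟨t, i, hi, hle⟩ := exists_touching a hb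
  obtain ⟨k, hk⟩ := ha i
  refine le_trans ?_ (pointDist_le_setDist W k _)
  refine le_pointDist_hyperplane (i := i) (by rw [hi]; exact WithBot.coe_ne_bot) fun j hj => ?_
  refine (add_le_add_right (add_le_add_left (hle j) _) _).trans ?_
  rw [hi]
  norm_cast
  linarith [hk j hj]

theorem IsSubEig.pointDist_le {W : Fin n → Fin p → ℝ} (hn : 0 < n) {c : ℝ} {a : Fin n → ℝ}
    (ha : IsSubEig W c a) (k : Fin p) :
    pointDist (toRmax fun i => W i k) (hyperplane (toRmax a)) ≤ ((-c : ℝ) : EReal) := by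
  refine pointDist_hyperplane_le hn fun i => ?_
  obtain ⟨j, hj, h⟩ := ha i k
  exact ⟨j, hj, by linarith⟩

theorem IsSubEig.setDist_le {W : Fin n → Fin p → ℝ} (hn : 0 < n) {c : ℝ} {a : Fin n → ℝ}
    (ha : IsSubEig W c a) :
    setDist (points (coeMatrix W)) (hyperplane (toRmax a)) ≤ ((-c : ℝ) : EReal) := by
  refine iSup₂_le ?_
  rintro _ ⟨k, rfl⟩
  exact ha.pointDist_le hn k

theorem setDist_eq_of_eig {W : Fin n → Fin p → ℝ} (hn : 0 < n) {c : ℝ} {a : Fin n → ℝ}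
    (ha : IsSuperEig W c a) (ha' : IsSubEig W c a) :
    setDist (points (coeMatrix W)) (hyperplane (toRmax a)) = ((-c : ℝ) : EReal) :=
  le_antisymm (ha'.setDist_le hn) (ha.neg_le_setDist (toRmax_ne_bot hn a))

theorem IsSubEig.nonpos [Nonempty (Fin p)] {W : Fin n → Fin p → ℝ} (hn : 0 < n) {c : ℝ}
    {a : Fin n → ℝ} (ha : IsSubEig W c a) : c ≤ 0 := by
  obtain ⟨k⟩ := ‹Nonempty (Fin p)›
  obtain ⟨i, -, hi⟩ := Finset.exists_max_image Finset.univ (fun i => W i k + a i)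
    ⟨⟨0, hn⟩, Finset.mem_univ _⟩
  obtain ⟨j, -, h⟩ := ha i k
  linarith [hi j (Finset.mem_univ _)]

/-- The distance from the points to a hyperplane with finite apex is finite. -/
theorem exists_setDist_eq_coe [Nonempty (Fin p)] (hn : 2 ≤ n) (W : Fin n → Fin p → ℝ)
    (a : Fin n → ℝ) :
    ∃ r : ℝ, setDist (points (coeMatrix W)) (hyperplane (toRmax a)) = (r : EReal) := by
  have : Nontrivial (Fin n) := Fin.nontrivial_iff_two_le.2 hn
  obtain ⟨M, hM⟩ := (Set.finite_range fun q : Fin n × Fin n × Fin p =>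
    W q.1 q.2.2 + a q.1 - (W q.2.1 q.2.2 + a q.2.1)).bddAbove
  have hM' : ∀ i j k, W i k + a i - (W j k + a j) ≤ M := fun i j k => hM ⟨(i, j, k), rfl⟩
  -- Crude sub- and super-eigenvalues confine the distance between `-M` and `M`.
  have hsub : IsSubEig W (-M) a := fun i k => by
    obtain ⟨j, hj⟩ := exists_ne i
    exact ⟨j, hj, by linarith [hM' i j k]⟩
  have hsuper : IsSuperEig W M a := fun i => by
    obtain ⟨k⟩ := ‹Nonempty (Fin p)›
    exact ⟨k, fun j _ => by linarith [hM' j i k]⟩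
  have h1 := hsub.setDist_le (by omega)
  have h2 := hsuper.neg_le_setDist (toRmax_ne_bot (by omega) a)
  refine ⟨_, (EReal.coe_toReal ?_ ?_).symm⟩
  · exact fun h => EReal.coe_ne_top _ (top_le_iff.1 (h ▸ h1))
  · exact fun h => EReal.coe_ne_bot _ (le_bot_iff.1 (h ▸ h2))

theorem mem_sector_iff {x a : Fin n → ℝ} {i : Fin n} :
    toRmax x ∈ sector a i ↔ ∀ j, x j + a j ≤ x i + a i := by
  simp only [sector, toRmax, Set.mem_ofPred_eq]
  norm_cast

/-- The column chosen for `i` leads by at least `-c ≥ 0`, hence lies in the sector; the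
sub-eigenvector inequality makes its distance exactly `-c`. -/
theorem exists_witness_of_eig [Nonempty (Fin p)] {W : Fin n → Fin p → ℝ} (hn : 0 < n) {c : ℝ}
    {a : Fin n → ℝ} (ha : IsSuperEig W c a) (ha' : IsSubEig W c a) (i : Fin n) :
    ∃ v ∈ sector a i, IsWitness (points (coeMatrix W)) (toRmax a) v := by
  have hc := ha'.nonpos hn
  obtain ⟨k, hk⟩ := ha i
  refine ⟨toRmax fun i => W i k, mem_sector_iff.2 fun j => ?_, ⟨k, rfl⟩, ?_⟩
  · by_cases hj : j = i
    · rw [hj]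
    · linarith [hk j hj]
  · rw [setDist_eq_of_eig hn ha ha']
    refine le_antisymm (ha'.pointDist_le hn k) (le_pointDist_hyperplane (i := i)
      WithBot.coe_ne_bot fun j hj => ?_)
    simp only [toRmax]
    norm_cast
    linarith [hk j hj]

theorem eig_of_witness [Nonempty (Fin p)] {W : Fin n → Fin p → ℝ} (hn : 2 ≤ n)
    {a : Fin n → ℝ}
    (h : ∀ i, ∃ v ∈ sector a i, IsWitness (points (coeMatrix W)) (toRmax a) v) :
    ∃ c, IsSuperEig W c a ∧ IsSubEig W c a := by
  have : Nontrivial (Fin n) := Fin.nontrivial_iff_two_le.2 hn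
  obtain ⟨r, hr⟩ := exists_setDist_eq_coe hn W a
  -- A witness in sector `i` leads there by its distance `r`, and no column can lead by more than
  -- `r`.
  refine ⟨-r, fun i => ?_, fun i k => ?_⟩
  · obtain ⟨_, hv, ⟨k, rfl⟩, hk⟩ := h i
    have hs : ∀ j, W j k + a j ≤ W i k + a i := mem_sector_iff.1 hv
    refine ⟨k, fun j hj => ?_⟩
    by_contra! hlt
    have hle : pointDist (toRmax fun i => W i k) (hyperplane (toRmax a)) ≤
        ((W i k + a i - (W j k + a j) : ℝ) : EReal) := by
      refine pointDist_hyperplane_le (by omega) fun l => ?_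
      by_cases hl : l = i
      · exact ⟨j, hl ▸ hj, by rw [hl]; linarith⟩
      · exact ⟨i, Ne.symm hl, by linarith [hs l, hs j]⟩
    have hk' : pointDist (toRmax fun i => W i k) (hyperplane (toRmax a)) = (r : EReal) :=
      hk.trans hr
    rw [hk'] at hle
    have := EReal.coe_le_coe_iff.1 hle
    linarith
  · by_contra! hlt
    obtain ⟨j₀, hj₀⟩ := exists_ne i
    obtain ⟨j, hj, hjmax⟩ := Finset.exists_max_image (Finset.univ.erase i)
      (fun j => W j k + a j) ⟨j₀, by simp [hj₀]⟩
    have hle : ((W i k + a i - (W j k + a j) : ℝ) : EReal) ≤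
        pointDist (toRmax fun i => W i k) (hyperplane (toRmax a)) := by
      refine le_pointDist_hyperplane (i := i) WithBot.coe_ne_bot fun l hl => ?_
      have := hjmax l (by simp [hl])
      simp only [toRmax]
      norm_cast
      linarith
    have := EReal.coe_le_coe_iff.1 ((hle.trans (pointDist_le_setDist W k _)).trans hr.le)
    linarith [hlt j (Finset.ne_of_mem_erase hj)]

end Distance

/-! ### Balls inscribed in the tropical span -/

section InnerBall

variable {n p : ℕ}

theorem subset_tropicalSpan (A : Set (Fin n → Rmax)) : A ⊆ tropicalSpan A :=
  Set.subset_sInter fun _ hC => hC.2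

theorem isTropicalCone_tropicalSpan (A : Set (Fin n → Rmax)) :
    IsTropicalCone (tropicalSpan A) :=
  ⟨fun x hx c C hC => hC.1.1 x (hx C hC) c, fun x hx y hy C hC => hC.1.2 x (hx C hC) y (hy C hC)⟩

theorem IsTropicalCone.sup'_mem {C : Set (Fin n → Rmax)} (hC : IsTropicalCone C) {ι : Type*}
    {s : Finset ι} (hs : s.Nonempty) {f : ι → Fin n → Rmax} (hf : ∀ i ∈ s, f i ∈ C) :
    s.sup' hs f ∈ C :=
  Finset.sup'_induction hs f (fun x hx y hy => hC.2 x hx y hy) hf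

/-- Every finite coordinate of a point of the tropical span of `A` is realized by a translate of
some point of `A`. -/
theorem exists_shift_le_of_mem_tropicalSpan {A : Set (Fin n → Rmax)} {x : Fin n → Rmax}
    (hx : x ∈ tropicalSpan A) (i : Fin n) (hi : x i ≠ ⊥) :
    ∃ v ∈ A, ∃ c : Rmax, shift c v ≤ x ∧ shift c v i = x i := by
  revert i
  -- The span is the least cone containing `A`, so it suffices that the property defines such a
  -- cone.
  refine hx {x | ∀ i, x i ≠ ⊥ → ∃ v ∈ A, ∃ c : Rmax, shift c v ≤ x ∧ shift c v i = x i}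
    ⟨⟨?_, ?_⟩, ?_⟩
  · intro x hx c i hi
    have hxi : x i ≠ ⊥ := fun h => hi (by simp [shift, h])
    obtain ⟨v, hv, d, hle, heq⟩ := hx i hxi
    refine ⟨v, hv, c + d, fun j => ?_, ?_⟩
    · simp only [shift, add_assoc]
      exact add_le_add_right (hle j) c
    · simp only [shift, add_assoc] at heq ⊢
      rw [heq]
  · intro x hx y hy i hi
    rcases le_total (x i) (y i) with h | h
    · have hxy : (x ⊔ y) i = y i := sup_eq_right.2 h
      obtain ⟨v, hv, d, hle, heq⟩ := hy i (hxy ▸ hi)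
      exact ⟨v, hv, d, hle.trans le_sup_right, heq.trans hxy.symm⟩
    · have hxy : (x ⊔ y) i = x i := sup_eq_left.2 h
      obtain ⟨v, hv, d, hle, heq⟩ := hx i (hxy ▸ hi)
      exact ⟨v, hv, d, hle.trans le_sup_left, heq.trans hxy.symm⟩
  · intro v hv i _
    exact ⟨v, hv, 0, fun j => by simp [shift], by simp [shift]⟩

/-- A point `z` of the ball is the supremum of `n` columns: the one chosen for `i`, shifted to agree
with `z` at `i`, stays below `z` elsewhere. -/
theorem IsSuperEig.hilbertBall_subset (hn : 0 < n) {W : Fin n → Fin p → ℝ} {c : ℝ}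
    {a : Fin n → ℝ} (ha : IsSuperEig W c a) :
    hilbertBall (-a) ((-c : ℝ) : EReal) ⊆ tropicalSpan (points (coeMatrix W)) := by
  intro x hx
  obtain ⟨z, rfl, hz⟩ := (hilbertDist_toRmax_le_iff hn).1 hx
  choose k hk using ha
  have hne : (Finset.univ : Finset (Fin n)).Nonempty := ⟨⟨0, hn⟩, Finset.mem_univ _⟩
  have hmem := (isTropicalCone_tropicalSpan (points (coeMatrix W))).sup'_mem hne
    (f := fun i => shift ((z i - W i (k i) : ℝ) : Rmax) (toRmax fun j => W j (k i)))
    fun i _ => (isTropicalCone_tropicalSpan _).1 _ (subset_tropicalSpan _ (Set.mem_range_self (k i))) _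
  convert hmem using 1
  apply le_antisymm
  · intro i
    refine le_trans ?_ (Finset.le_sup' (fun i => shift ((z i - W i (k i) : ℝ) : Rmax)
      (toRmax fun j => W j (k i))) (Finset.mem_univ i) i)
    simp only [shift, toRmax]
    norm_cast
    linarith
  · refine Finset.sup'_le _ _ fun i _ j => ?_
    simp only [shift, toRmax]
    norm_cast
    by_cases hj : j = i
    · rw [hj]
      linarith
    · have h1 := hk i j hj
      have h2 := hz i j
      simp only [Pi.neg_apply] at h2
      linarith

/-- If a ball of center `b` and radius at least `s ≥ 0` is included in the tropical span of the
columns of `W`, then `-b` is a super-eigenvector for `-s`. -/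
theorem isSuperEig_of_hilbertBall_subset (hn : 0 < n) {W : Fin n → Fin p → ℝ} {b : Fin n → ℝ}
    {r : EReal} (h : hilbertBall b r ⊆ tropicalSpan (points (coeMatrix W))) {s : ℝ} (hs : 0 ≤ s)
    (hsr : (s : EReal) ≤ r) : IsSuperEig W (-s) (-b) := by
  intro i
  -- Raise coordinate `i` of the center by `s`; a generator touching this point at `i` leads there
  -- by at least `s`.
  have hmem : toRmax (Function.update b i (b i + s)) ∈ hilbertBall b r := by
    refine le_trans ((hilbertDist_toRmax_le_iff hn).2 ⟨_, rfl, ?_⟩) hsr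
    have hbd : ∀ l, 0 ≤ Function.update b i (b i + s) l - b l ∧
        Function.update b i (b i + s) l - b l ≤ s := by
      intro l
      by_cases hl : l = i
      · subst hl
        simp [hs]
      · simp [hl, hs]
    intro l l'
    linarith [(hbd l).2, (hbd l').1]
  obtain ⟨_, ⟨k, rfl⟩, d, hle, heq⟩ :=
    exists_shift_le_of_mem_tropicalSpan (h hmem) i WithBot.coe_ne_bot
  have hd : d ≠ ⊥ := by
    rintro rfl
    simp only [shift, WithBot.bot_add] at heq
    exact WithBot.coe_ne_bot heq.symm
  obtain ⟨d, rfl⟩ := WithBot.ne_bot_iff_exists.1 hd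
  refine ⟨k, fun j hj => ?_⟩
  have hj' := hle j
  simp only [shift, toRmax, coeMatrix, Function.update_self, Function.update_of_ne hj]
    at hj' heq
  norm_cast at hj' heq
  simp only [Pi.neg_apply]
  linarith

theorem isMaximalInnerBall_of_eig [Nonempty (Fin p)] (hn : 0 < n) {W : Fin n → Fin p → ℝ} {c : ℝ}
    {a : Fin n → ℝ} (ha : IsSuperEig W c a) (ha' : IsSubEig W c a) :
    IsMaximalInnerBall (points (coeMatrix W)) (-a) ((-c : ℝ) : EReal) := by
  have hc := ha'.nonpos hn
  refine ⟨ha.hilbertBall_subset hn, le_antisymm ?_ ?_⟩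
  · exact le_sSup ⟨by exact_mod_cast neg_nonneg.2 hc, -a, ha.hilbertBall_subset hn⟩
  · refine sSup_le ?_
    rintro r ⟨hr, b, hb⟩
    by_contra! hlt
    -- A larger ball, possibly of radius `⊤`, would give a real `s > -c` bounding from below the
    -- distance to `H_a`, which is at most `-c`.
    obtain ⟨s, hcs, hs⟩ := EReal.lt_iff_exists_real_btwn.1 hlt
    have hcs' : -c < s := EReal.coe_lt_coe_iff.1 hcs
    have hsup := isSuperEig_of_hilbertBall_subset hn hb (by linarith) hs.le
    have hle := (hsup.neg_le_setDist (toRmax_ne_bot hn a)).trans (ha'.setDist_le hn)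
    have := EReal.coe_le_coe_iff.1 hle
    linarith

end InnerBall

/-! ### Dimension one -/

section DimensionOne

variable {p : ℕ}

theorem shapley_dim_one {V : Matrix (Fin 1) (Fin p) Rmax} (hV : NoBotRowCol V)
    (x : Fin 1 → Rmax) : shapley V hV x = ⊥ := by
  funext i
  have h : (Finset.univ.erase i : Finset (Fin 1)) = ∅ := by
    ext j
    simp [Subsingleton.elim j i]
  simp only [shapley, h, Finset.sup_empty, WithBot.add_bot, Finset.inf'_const, Pi.bot_apply]

theorem spectralRad_dim_one {V : Matrix (Fin 1) (Fin p) Rmax} (hV : NoBotRowCol V) :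
    spectralRad (shapley V hV) = ⊥ := by
  refine sSup_eq_bot.2 ?_
  rintro _ ⟨c, rfl, u, hu, h⟩
  obtain ⟨i, hi⟩ := Function.ne_iff.1 hu
  have := congrFun h i
  rw [shapley_dim_one] at this
  rcases WithBot.add_eq_bot.1 this.symm with hc | hc
  · rw [hc, toEReal_bot]
  · exact absurd hc hi

theorem isFiniteEigenvector_dim_one {V : Matrix (Fin 1) (Fin p) Rmax} (hV : NoBotRowCol V)
    (a : Fin 1 → ℝ) : IsFiniteEigenvector (shapley V hV) a := by
  intro i
  rw [spectralRad_dim_one, shapley_dim_one]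
  simp

theorem pointDist_hyperplane_dim_one (x b : Fin 1 → Rmax) : pointDist x (hyperplane b) = ⊤ := by
  have h : hyperplane b = ∅ := by
    ext y
    simp only [hyperplane, Set.mem_ofPred_eq, Set.mem_empty_iff_false, iff_false]
    rintro ⟨i, j, hij, -⟩
    exact hij (Subsingleton.elim i j)
  simp [pointDist, h]

theorem setDist_hyperplane_dim_one {A : Set (Fin 1 → Rmax)} (hA : A.Nonempty)
    (b : Fin 1 → Rmax) : setDist A (hyperplane b) = ⊤ := by
  obtain ⟨x, hx⟩ := hA
  refine top_le_iff.1 ?_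
  rw [← pointDist_hyperplane_dim_one x b]
  exact le_iSup₂ (f := fun x (_ : x ∈ A) => pointDist x (hyperplane b)) x hx

theorem tropicalSpan_dim_one {A : Set (Fin 1 → Rmax)} {v : Fin 1 → Rmax} (hv : v ∈ A)
    (hv0 : v 0 ≠ ⊥) : tropicalSpan A = Set.univ := by
  refine Set.eq_univ_of_forall fun x => ?_
  obtain ⟨r, hr⟩ := WithBot.ne_bot_iff_exists.1 hv0
  convert (isTropicalCone_tropicalSpan A).1 v (subset_tropicalSpan A hv) (x 0 + ((-r : ℝ) : Rmax))
    using 1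
  funext i
  rw [Subsingleton.elim i 0, shift, ← hr, add_assoc, ← WithBot.coe_add]
  simp

end DimensionOne

end TropReg

theorem mainTheorem8 {n p : ℕ} (hn : 0 < n) (V : Matrix (Fin n) (Fin p) Rmax)
    (hV : NoBotRowCol V) (hfin : ∀ v ∈ points V, ∀ i, v i ≠ ⊥) :
    (∃ a : Fin n → ℝ, IsFiniteEigenvector (shapley V hV) a) ∧
    (2 ≤ n → ∃ r : ℝ, spectralRad (shapley V hV) = (r : EReal)) ∧
    ∀ a : Fin n → ℝ,
      (IsFiniteEigenvector (shapley V hV) a ↔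
        ∀ i, ∃ v ∈ sector a i, IsWitness (points V) (toRmax a) v) ∧
      (IsFiniteEigenvector (shapley V hV) a →
        spectralRad (shapley V hV) = -setDist (points V) (hyperplane (toRmax a)) ∧
        IsOptimalHyperplane (points V) (toRmax a) ∧
        IsMaximalInnerBall (points V) (-a)
          (setDist (points V) (hyperplane (toRmax a)))) := by
  obtain ⟨k₀, -⟩ := hV.1 ⟨0, hn⟩
  have : Nonempty (Fin p) := ⟨k₀⟩
  rcases Nat.lt_or_ge n 2 with hn1 | hn2
  · obtain rfl : n = 1 := by omega
    have hv₀ : (fun i => V i k₀) ∈ points V := ⟨k₀, rfl⟩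
    have hne : (points V).Nonempty := ⟨_, hv₀⟩
    have hspan := tropicalSpan_dim_one hv₀ (hfin _ hv₀ 0)
    refine ⟨⟨0, isFiniteEigenvector_dim_one hV 0⟩, fun h => by omega, fun a => ⟨?_, fun _ => ?_⟩⟩
    · refine iff_of_true (isFiniteEigenvector_dim_one hV a) fun i => ⟨_, fun j => ?_, hv₀, ?_⟩
      · rw [Subsingleton.elim j i]
      · rw [pointDist_hyperplane_dim_one, setDist_hyperplane_dim_one hne]
    · rw [spectralRad_dim_one]
      simp only [IsOptimalHyperplane, IsMaximalInnerBall, innerRadius,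
        setDist_hyperplane_dim_one hne, hspan]
      refine ⟨EReal.neg_top.symm, ⟨toRmax_ne_bot hn a, fun _ _ => le_rfl⟩, Set.subset_univ _, ?_⟩
      exact (top_le_iff.1 (le_sSup (Set.mem_ofPred.2 ⟨le_top, -a, Set.subset_univ _⟩))).symm
  · obtain ⟨W, rfl⟩ : ∃ W : Fin n → Fin p → ℝ, V = coeMatrix W := by
      choose W hW using fun i k => WithBot.ne_bot_iff_exists.1 (hfin (fun i => V i k) ⟨k, rfl⟩ i)
      exact ⟨W, funext fun i => funext fun k => (hW i k).symm⟩
    obtain ⟨c, a₀, h₀, h₀'⟩ := exists_superEig_subEig hn2 W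
    have hc := spectralRad_eq_of_eig hn2 hV h₀ h₀'
    have heig := isFiniteEigenvector_iff hn2 hV hc
    refine ⟨⟨a₀, (heig a₀).2 ⟨h₀, h₀'⟩⟩, fun _ => ⟨c, hc⟩, fun a => ⟨⟨fun h i => ?_, fun h => ?_⟩,
      fun h => ?_⟩⟩
    · exact exists_witness_of_eig hn ((heig a).1 h).1 ((heig a).1 h).2 i
    -- Witnesses produce an eigenvalue `d` of their own, which must be the spectral radius.
    · obtain ⟨d, hd, hd'⟩ := eig_of_witness hn2 h
      exact (isFiniteEigenvector_iff hn2 hV (spectralRad_eq_of_eig hn2 hV hd hd') a).2 ⟨hd, hd'⟩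
    · obtain ⟨ha, ha'⟩ := (heig a).1 h
      rw [IsOptimalHyperplane, setDist_eq_of_eig hn ha ha', hc]
      refine ⟨?_, ⟨toRmax_ne_bot hn a, fun b hb => ha.neg_le_setDist hb⟩,
        isMaximalInnerBall_of_eig hn ha ha'⟩
      rw [← EReal.coe_neg, neg_neg]
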